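/- Let $I=[-\tfrac12,\tfrac12]$ with Lebesgue measure $m$, and let $\Sigma=I\times I$ with the sup distance. Let $F:\Sigma\to\Sigma$ be a Borel map of the form $F(x,y)=(T(x),G(x,y))$, and let $\mu_F$ be an $F$-invariant Borel probability measure on $\Sigma$ with marginal $\mu_x$ on the first coordinate. Write $\|f\|_{BV}=\|f\|_{L^1(m)}+\operatorname{var}(f)$ for $f:I\to\mathbb R$ and $\|f\|_{lip}=\|f\|_\infty+L(f)$ for $f:\Sigma\to\mathbb R$, where $L(f)$ is the best Lipschitz constant. Assume: 1. there are $C,\theta>0$ such that, for all $g\in L^1(m)$, all $f:I\to\mathbb R$ of bounded variation and all $n\ge 0$, $$\Big|\int g(T^n(x))f(x)\,dm-\int g\,d\mu_x\int f\,dm\Big|\le C\,\|g\|_{L^1(m)}\,\|f\|_{BV}\,e^{-\theta n},$$ and $T^{-1}(x)$ is finite for each $x\in I$; 2. there is $\lambda<1$ such that $y\mapsto G(x,y)$ is $\lambda$-Lipschitz for each $x\in I$; 3. there is $K$ such that, for each Lipschitz $f:\Sigma\to\mathbb R$, the projection to the first coordinate of the signed measure $f\mu_F$ has a density $\bar f$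 with respect to $m$ of bounded variation, with $\operatorname{var}(\bar f)\le K\|f\|_{lip}$. For $x,x_0\in\Sigma$ and $r>0$ let $B_r(x_0)$ be the closed ball and $$\tau_r^\Sigma(x,x_0)=\min\{n\ge 1: F^n(x)\in B_r(x_0)\}$$ ($=\infty$ if there is no such $n$), and let $d_{\mu_F}(x_0)=\lim_{r\to0}\frac{\log\mu_F(B_r(x_0))}{\log r}$ whenever this limit exists in $[0,\infty]$ (with $\log 0=-\infty$, $\log\infty=\infty$). Then for each $x_0\in\Sigma$ such that $d_{\mu_F}(x_0)$ exists, $$\lim_{r\to 0}\frac{\log\tau_r^\Sigma(x,x_0)}{-\log r}=d_{\mu_F}(x_0)\qquad\text{for }\mu_F\text{-almost every }x\in\Sigma.$$ -/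

import Mathlib

open MeasureTheory Filter Topology
open scoped NNReal ENNReal

noncomputable section

namespace LorenzLike

/-- The unit interval `I = [-1/2, 1/2]`, with the distance and the order of `ℝ`. -/
abbrev I : Type := Set.Icc (-1 / 2 : ℝ) (1 / 2)

/-- Lebesgue measure on `I`. -/
def leb : Measure I := Measure.comap Subtype.val volume

/-- The square `I × I`. The distance of the product is the sup distance. -/
abbrev Square : Type := I × I

/-- The fibred map `F (x, y) = (T x, G (x, y))`. -/
def fibredMap (T : I → I) (G : I → I → I) : Square → Square :=
  fun p => (T p.1, G p.1 p.2)

/-- The total variation of `f` over `I`, plus its `L¹` norm for Lebesgue measure. -/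
def bvNorm (f : I → ℝ) : ℝ :=
  (∫ x, |f x| ∂leb) + (eVariationOn f Set.univ).toReal

/-- Exponential decay of correlations of `T` between `L¹` and BV observables on `I`, for Lebesgue
measure and the measure `ν`. -/
def DecayL1BV (T : I → I) (ν : Measure I) : Prop :=
  ∃ C > (0 : ℝ), ∃ θ > (0 : ℝ), ∀ g : I → ℝ, Measurable g → Integrable g leb →
    ∀ f : I → ℝ, BoundedVariationOn f Set.univ → ∀ n : ℕ,
      |(∫ x, g (T^[n] x) * f x ∂leb) - (∫ x, g x ∂ν) * ∫ x, f x ∂leb|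
        ≤ C * (∫ x, |g x| ∂leb) * bvNorm f * Real.exp (-θ * n)

/-- `h` is a density with respect to Lebesgue measure of the (signed) measure on `I` which is the
projection to the first coordinate of the measure `f μ`. -/
def IsMarginalDensity (μ : Measure Square) (f : Square → ℝ) (h : I → ℝ) : Prop :=
  Integrable h leb ∧ ∀ A : Set I, MeasurableSet A →
    ∫ p in Prod.fst ⁻¹' A, f p ∂μ = ∫ x in A, h x ∂leb

/-- Each `f μ` with `f` Lipschitz has a marginal density of bounded variation, with variation at
most a fixed multiple of the Lipschitz norm (sup norm plus Lipschitz constant) of `f`. -/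
def RegularMarginals (μ : Measure Square) : Prop :=
  ∃ K : ℝ≥0, ∀ (f : Square → ℝ) (l : ℝ≥0), LipschitzWith l f →
    ∃ h : I → ℝ, IsMarginalDensity μ f h ∧
      eVariationOn h Set.univ ≤ K * ((⨆ p, ‖f p‖ₑ) + l)

/-- The standing assumptions on the fibred map `F (x, y) = (T x, G (x, y))` and on the
measure `μ`. -/
structure IsLorenzLike (T : I → I) (G : I → I → I) (μ : Measure Square) : Prop where
  isProbabilityMeasure : IsProbabilityMeasure μ
  /-- `F` is Borel and `μ` is invariant. -/
  invariant : MeasurePreserving (fibredMap T G) μ μ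
  decay : DecayL1BV T (μ.map Prod.fst)
  finite_preimage : ∀ x : I, (T ⁻¹' {x}).Finite
  contraction : ∃ c : ℝ≥0, c < 1 ∧ ∀ x : I, LipschitzWith c (G x)
  regular : RegularMarginals μ

/-- The local dimension of `μ` at `x₀` exists and is equal to `d`. The logarithm is the extended
one (`log 0 = -∞`), so the value `d = ∞` is allowed. -/
def HasLocalDim {M : Type*} [PseudoMetricSpace M] [MeasurableSpace M]
    (μ : Measure M) (x₀ : M) (d : EReal) : Prop :=
  Tendsto (fun r : ℝ => ENNReal.log (μ (Metric.closedBall x₀ r)) / ((Real.log r : ℝ) : EReal))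
    (𝓝[>] 0) (𝓝 d)

/-- The first `n ≥ 1` with `F^n x` in the ball of radius `r` around `x₀`; it is `⊤` if there is
no such `n`. -/
def hittingTime {M : Type*} [PseudoMetricSpace M] (F : M → M) (r : ℝ) (x x₀ : M) : ℕ∞ :=
  ⨅ (n : ℕ) (_ : 1 ≤ n ∧ F^[n] x ∈ Metric.closedBall x₀ r), (n : ℕ∞)

end LorenzLike

end

namespace LorenzLike

/-! ### Passing between radii and dyadic radii -/

/-! Monotonicity of the hitting time in the radius reduces everything to balls of radius `2⁻ᵏ`,
followed by Borel–Cantelli in `k`.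

Lower bound (`ae_eventually_lt_log_hittingTime`): invariance alone suffices. If `u < s < d`, the
points that enter the ball before time `2 ^ (k * u)` have measure at most `2 ^ (k * u) * 2 ^ (-(k *
s))`, which is summable.

Upper bound: let `f` be a bump at scale `2⁻ᵏ`, with mean `a ≥ 2 ^ (-(k + 1) * s)` for some `s > d`.
On an orbit avoiding the support of `f` up to time `N`, the centred Birkhoff sum equals `-N * a`, so
Chebyshev bounds the measure of such orbits by the summed correlations
(`measureReal_forall_eq_zero_le`). These are at most `a` each, and exponentially small after a time
of order `k`; hence the measure is `O(k / (N * a))`, summable for `N ≈ 2 ^ (k * u)` with `u > s`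
(`LipschitzDecay.measureReal_avoid_le`).

Decay of correlations (`IsLorenzLike.exists_correlation_le`): after `k` steps the contraction makes
`f ∘ F^k` nearly a function `φ` of the first coordinate. The correlation of `φ ∘ T^n` with `f` is an
integral against the BV marginal density of `f μ`, to which the mixing of `T` applies. -/

theorem tendsto_neg_log_div_log_two :
    Tendsto (fun r : ℝ => -Real.log r / Real.log 2) (𝓝[>] 0) atTop :=
  (tendsto_neg_atBot_atTop.comp Real.tendsto_log_nhdsGT_zero).atTop_div_const
    (Real.log_pos one_lt_two)

theorem log_half_pow (k : ℕ) : Real.log ((1 / 2 : ℝ) ^ k) = -(k * Real.log 2) := by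
  rw [Real.log_pow, one_div, Real.log_inv]
  ring

/-- Rounding `r` to a dyadic radius changes `log r` by at most `log 2`; the gap between `t` and `u`
absorbs this. -/
theorem eventually_lt_div_neg_log {L : ℝ → EReal} (hL : Antitone L) {t u : ℝ} (htu : t < u)
    (hu : 0 ≤ u) (h : ∀ᶠ k : ℕ in atTop, ((k * u * Real.log 2 : ℝ) : EReal) ≤ L ((1 / 2) ^ k)) :
    ∀ᶠ r : ℝ in 𝓝[>] 0, (t : EReal) < L r / ((-Real.log r : ℝ) : EReal) := by
  have h2 : 0 < Real.log 2 := Real.log_pos one_lt_two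
  have hy := tendsto_neg_log_div_log_two
  -- For `k = ⌊y⌋₊ > y - 1`, the second threshold gives `t * y < (y - 1) * u ≤ k * u`.
  filter_upwards [hy.eventually_gt_atTop 0, hy.eventually_gt_atTop (u / (u - t)),
    (tendsto_nat_floor_atTop.comp hy).eventually h, self_mem_nhdsWithin] with r hr0 hr1 hr2 hr
  have hr : 0 < r := hr
  set y := -Real.log r / Real.log 2 with hydef
  have hlog : -Real.log r = y * Real.log 2 := by rw [hydef]; field_simp
  simp only [Function.comp_apply] at hr2
  have hk1 := Nat.floor_le hr0.le
  have hk2 := Nat.lt_floor_add_one y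
  have hle : r ≤ (1 / 2) ^ ⌊y⌋₊ := by
    rw [← Real.log_le_log_iff hr (by positivity), log_half_pow]
    nlinarith
  rw [hlog, EReal.lt_div_iff (by exact_mod_cast mul_pos hr0 h2) (EReal.coe_ne_top _)]
  refine lt_of_lt_of_le ?_ (hr2.trans (hL hle))
  rw [div_lt_iff₀ (by linarith)] at hr1
  norm_cast
  rw [← mul_assoc]
  refine mul_lt_mul_of_pos_right ?_ h2
  nlinarith

/-- The summand `1` is negligible in the limit and leaves room for rounding `2 ^ (k * u)` up to an
integer. -/
theorem eventually_div_neg_log_lt {L : ℝ → EReal} (hL : Antitone L) {t u : ℝ} (hut : u < t)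
    (hu : 0 ≤ u)
    (h : ∀ᶠ k : ℕ in atTop, L ((1 / 2) ^ k) ≤ (((1 + k * u) * Real.log 2 : ℝ) : EReal)) :
    ∀ᶠ r : ℝ in 𝓝[>] 0, L r / ((-Real.log r : ℝ) : EReal) < (t : EReal) := by
  have h2 : 0 < Real.log 2 := Real.log_pos one_lt_two
  have hy := tendsto_neg_log_div_log_two
  filter_upwards [hy.eventually_gt_atTop 0, hy.eventually_gt_atTop ((1 + u) / (t - u)),
    (((tendsto_add_atTop_nat 1).comp tendsto_nat_floor_atTop).comp hy).eventually h,
    self_mem_nhdsWithin] with r hr0 hr1 hr2 hr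
  have hr : 0 < r := hr
  set y := -Real.log r / Real.log 2 with hydef
  have hlog : -Real.log r = y * Real.log 2 := by rw [hydef]; field_simp
  simp only [Function.comp_apply] at hr2
  have hk1 := Nat.floor_le hr0.le
  have hk2 := Nat.lt_floor_add_one y
  have hle : (1 / 2) ^ (⌊y⌋₊ + 1) ≤ r := by
    rw [← Real.log_le_log_iff (by positivity) hr, log_half_pow]
    push_cast
    nlinarith
  rw [hlog, EReal.div_lt_iff (by exact_mod_cast mul_pos hr0 h2) (EReal.coe_ne_top _)]
  refine lt_of_le_of_lt ((hL hle).trans hr2) ?_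
  rw [div_lt_iff₀ (by linarith)] at hr1
  norm_cast
  rw [← mul_assoc]
  refine mul_lt_mul_of_pos_right ?_ h2
  push_cast
  nlinarith

/-! ### Hitting times -/

section HittingTime

variable {M : Type*} [PseudoMetricSpace M]

theorem antitone_hittingTime (F : M → M) (x x₀ : M) :
    Antitone fun r : ℝ => hittingTime F r x x₀ := fun _ _ h =>
  le_iInf₂ fun n hn => iInf₂_le n ⟨hn.1, Metric.closedBall_subset_closedBall h hn.2⟩

theorem antitone_log_hittingTime (F : M → M) (x x₀ : M) :
    Antitone fun r : ℝ => ENNReal.log ((hittingTime F r x x₀ : ℕ∞) : ℝ≥0∞) := fun _ _ h =>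
  ENNReal.log_le_log (ENat.toENNReal_le.2 (antitone_hittingTime F x x₀ h))

theorem hittingTime_le {F : M → M} {r : ℝ} {x x₀ : M} {n N : ℕ} (hn : 1 ≤ n) (hN : n ≤ N)
    (h : F^[n] x ∈ Metric.closedBall x₀ r) : hittingTime F r x x₀ ≤ N :=
  (iInf₂_le n ⟨hn, h⟩).trans (by exact_mod_cast hN)

theorem le_hittingTime {F : M → M} {r : ℝ} {x x₀ : M} {N : ℕ}
    (h : ∀ n ∈ Finset.Icc 1 N, F^[n] x ∉ Metric.closedBall x₀ r) :
    ((N + 1 : ℕ) : ℕ∞) ≤ hittingTime F r x x₀ := by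
  refine le_iInf₂ fun n hn => ?_
  by_contra! hlt
  have : n < N + 1 := by exact_mod_cast hlt
  exact h n (Finset.mem_Icc.2 ⟨hn.1, by lia⟩) hn.2

end HittingTime

/-! ### Local dimension and the measure of dyadic balls -/

section Measure

variable {M : Type*} [PseudoMetricSpace M] [MeasurableSpace M]

theorem two_rpow_eq (a : ℝ) (k : ℕ) : (2 : ℝ) ^ (k * a) = ((2 : ℝ) ^ a) ^ k := by
  rw [mul_comm, Real.rpow_mul (by norm_num), Real.rpow_natCast]

theorem tendsto_half_pow : Tendsto (fun k : ℕ => (1 / 2 : ℝ) ^ k) atTop (𝓝[>] 0) :=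
  tendsto_nhdsWithin_iff.2 ⟨tendsto_pow_atTop_nhds_zero_of_lt_one (by norm_num) (by norm_num),
    Eventually.of_forall fun k => by simp only [Set.mem_Ioi]; positivity⟩

theorem log_ofReal_two_rpow (a : ℝ) :
    ENNReal.log (ENNReal.ofReal (2 ^ a)) = ((a * Real.log 2 : ℝ) : EReal) := by
  rw [ENNReal.log_ofReal_of_pos (by positivity), Real.log_rpow two_pos]

theorem HasLocalDim.nonneg {μ : Measure M} [IsProbabilityMeasure μ] {x₀ : M} {d : EReal}
    (hd : HasLocalDim μ x₀ d) : 0 ≤ d := by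
  refine ge_of_tendsto hd ?_
  filter_upwards [Ioo_mem_nhdsGT (zero_lt_one (α := ℝ))] with r hr
  refine EReal.div_nonneg_of_nonpos_of_nonpos (by simpa using prob_le_one) ?_
  exact_mod_cast Real.log_nonpos hr.1.le hr.2.le

theorem HasLocalDim.eventually_measure_le {μ : Measure M} {x₀ : M} {d : EReal}
    (hd : HasLocalDim μ x₀ d) {s : ℝ} (hs : (s : EReal) < d) :
    ∀ᶠ k : ℕ in atTop,
      μ (Metric.closedBall x₀ ((1 / 2) ^ k)) ≤ ENNReal.ofReal (2 ^ (-(k * s))) := by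
  filter_upwards [(hd.comp tendsto_half_pow).eventually (lt_mem_nhds hs), eventually_gt_atTop 0]
    with k hk hk0
  by_contra! hlt
  refine absurd hk (not_lt.2 ?_)
  have hlog := ENNReal.log_le_log hlt.le
  have hneg : Real.log ((1 / 2 : ℝ) ^ k) < 0 :=
    Real.log_neg (by positivity) (pow_lt_one₀ (by norm_num) (by norm_num) hk0.ne')
  refine (EReal.div_le_div_right_of_nonpos (by exact_mod_cast hneg.le) hlog).trans ?_
  rw [log_ofReal_two_rpow]
  norm_cast
  rw [← EReal.coe_div, EReal.coe_le_coe_iff, log_half_pow]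
  have : 0 < k * Real.log 2 := mul_pos (by exact_mod_cast hk0) (Real.log_pos one_lt_two)
  apply le_of_eq
  field_simp

theorem HasLocalDim.eventually_le_measure {μ : Measure M} {x₀ : M} {d : EReal}
    (hd : HasLocalDim μ x₀ d) {s : ℝ} (hs : d < s) :
    ∀ᶠ k : ℕ in atTop,
      ENNReal.ofReal (2 ^ (-(k * s))) ≤ μ (Metric.closedBall x₀ ((1 / 2) ^ k)) := by
  filter_upwards [(hd.comp tendsto_half_pow).eventually (gt_mem_nhds hs), eventually_gt_atTop 0]
    with k hk hk0
  by_contra! hlt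
  refine absurd hk (not_lt.2 ?_)
  have hlog := ENNReal.log_le_log hlt.le
  have hneg : Real.log ((1 / 2 : ℝ) ^ k) < 0 :=
    Real.log_neg (by positivity) (pow_lt_one₀ (by norm_num) (by norm_num) hk0.ne')
  refine le_trans ?_ (EReal.div_le_div_right_of_nonpos (by exact_mod_cast hneg.le) hlog)
  rw [log_ofReal_two_rpow]
  norm_cast
  rw [← EReal.coe_div, EReal.coe_le_coe_iff, log_half_pow]
  have : 0 < k * Real.log 2 := mul_pos (by exact_mod_cast hk0) (Real.log_pos one_lt_two)
  apply le_of_eq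
  field_simp

theorem ae_eventually_notMem_of_summable {α : Type*} [MeasurableSpace α] {μ : Measure α}
    {A : ℕ → Set α} {b : ℕ → ℝ} (hb : Summable b) (hb0 : ∀ k, 0 ≤ b k)
    (h : ∀ᶠ k in atTop, μ (A k) ≤ ENNReal.ofReal (b k)) : ∀ᵐ x ∂μ, ∀ᶠ k in atTop, x ∉ A k := by
  obtain ⟨K, hK⟩ := eventually_atTop.1 h
  have hsum : ∑' k, μ (A (k + K)) ≠ ∞ := by
    refine ne_top_of_le_ne_top ?_ (ENNReal.tsum_le_tsum fun k => hK (k + K) (Nat.le_add_left K k))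
    rw [← ENNReal.ofReal_tsum_of_nonneg (fun k => hb0 _) ((summable_nat_add_iff K).2 hb)]
    exact ENNReal.ofReal_ne_top
  filter_upwards [ae_eventually_notMem hsum] with x hx
  obtain ⟨J, hJ⟩ := eventually_atTop.1 hx
  refine eventually_atTop.2 ⟨J + K, fun k hk => ?_⟩
  have := hJ (k - K) (by lia)
  rwa [Nat.sub_add_cancel (by lia)] at this

theorem summable_two_rpow {a : ℝ} (ha : a < 0) : Summable fun k : ℕ => (2 : ℝ) ^ (k * a) := by
  simp_rw [two_rpow_eq]
  exact summable_geometric_of_lt_one (by positivity)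
    (Real.rpow_lt_one_of_one_lt_of_neg one_lt_two ha)

variable [OpensMeasurableSpace M]

theorem measure_hits_le {μ : Measure M} {F : M → M} (hF : MeasurePreserving F μ μ) (x₀ : M)
    (r : ℝ) (N : ℕ) :
    μ {x | ∃ n ∈ Finset.Icc 1 N, F^[n] x ∈ Metric.closedBall x₀ r}
      ≤ N * μ (Metric.closedBall x₀ r) := by
  have hset : {x | ∃ n ∈ Finset.Icc 1 N, F^[n] x ∈ Metric.closedBall x₀ r}
      = ⋃ n ∈ Finset.Icc 1 N, F^[n] ⁻¹' Metric.closedBall x₀ r := by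
    ext x
    simp
  rw [hset]
  refine (measure_biUnion_finset_le _ _).trans (le_of_eq ?_)
  rw [Finset.sum_congr rfl fun n _ => (hF.iterate n).measure_preimage
    Metric.isClosed_closedBall.measurableSet.nullMeasurableSet]
  simp

/-- The lower bound for hitting times holds for every measure preserving map. -/
theorem ae_eventually_lt_log_hittingTime {μ : Measure M} {F : M → M}
    (hF : MeasurePreserving F μ μ) {x₀ : M} {d : EReal} (hd : HasLocalDim μ x₀ d) {t : ℝ}
    (ht : (t : EReal) < d) :
    ∀ᵐ x ∂μ, ∀ᶠ r : ℝ in 𝓝[>] 0, (t : EReal) <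
      ENNReal.log ((hittingTime F r x x₀ : ℕ∞) : ℝ≥0∞) / ((-Real.log r : ℝ) : EReal) := by
  -- Negative `t` is trivial because hitting times are at least `1`; otherwise the exponent `u`
  -- below is nonnegative.
  rcases lt_or_ge t 0 with ht0 | ht0
  · refine Eventually.of_forall fun x => ?_
    refine eventually_lt_div_neg_log (antitone_log_hittingTime F x x₀) ht0 le_rfl
      (Eventually.of_forall fun k => ?_)
    simp only [mul_zero, zero_mul, EReal.coe_zero, ENNReal.zero_le_log_iff]
    have : ((0 + 1 : ℕ) : ℕ∞) ≤ hittingTime F ((1 / 2) ^ k) x x₀ := le_hittingTime (by simp)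
    simpa using ENat.toENNReal_le.2 this
  obtain ⟨s, hts, hsd⟩ := EReal.lt_iff_exists_real_btwn.1 ht
  have hts : t < s := by exact_mod_cast hts
  obtain ⟨u, htu, hus⟩ := exists_between hts
  have key := ae_eventually_notMem_of_summable (μ := μ)
    (A := fun k => {x | ∃ n ∈ Finset.Icc 1 ⌊(2 : ℝ) ^ (k * u)⌋₊,
      F^[n] x ∈ Metric.closedBall x₀ ((1 / 2) ^ k)})
    (b := fun k => (2 : ℝ) ^ (k * (u - s))) (summable_two_rpow (by linarith))
    (fun k => by positivity) ?_
  · filter_upwards [key] with x hx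
    refine eventually_lt_div_neg_log (antitone_log_hittingTime F x x₀) htu (by linarith) ?_
    filter_upwards [hx] with k hk
    rw [← log_ofReal_two_rpow]
    refine ENNReal.log_le_log ?_
    have h1 : ((⌊(2 : ℝ) ^ (k * u)⌋₊ + 1 : ℕ) : ℕ∞) ≤ hittingTime F ((1 / 2) ^ k) x x₀ :=
      le_hittingTime fun n hn hmem => hk ⟨n, hn, hmem⟩
    refine le_trans ?_ (ENat.toENNReal_le.2 h1)
    rw [ENat.toENNReal_coe]
    rw [← ENNReal.ofReal_natCast]
    exact ENNReal.ofReal_le_ofReal (by simpa using (Nat.lt_floor_add_one _).le)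
  · filter_upwards [hd.eventually_measure_le hsd] with k hk
    refine (measure_hits_le hF x₀ _ _).trans ?_
    have h1 : ((⌊(2 : ℝ) ^ (k * u)⌋₊ : ℕ) : ℝ≥0∞) ≤ ENNReal.ofReal ((2 : ℝ) ^ (k * u)) := by
      rw [ENNReal.le_ofReal_iff_toReal_le (by simp) (by positivity)]
      simpa using Nat.floor_le (by positivity)
    refine (mul_le_mul' h1 hk).trans ?_
    rw [← ENNReal.ofReal_mul (by positivity), ← Real.rpow_add two_pos]
    exact le_of_eq (by congr 2; ring)

end Measure

/-! ### The second moment of a Birkhoff sum -/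

/-- With truncated subtraction the argument of `c` is `|i - j|`, and each distance occurs at most
twice. -/
theorem sum_range_natDist_le {c : ℕ → ℝ} (hc : ∀ n, 0 ≤ c n) {i N : ℕ} (hi : i < N) :
    ∑ j ∈ Finset.range N, c ((i - j) + (j - i)) ≤ 2 * ∑ m ∈ Finset.range N, c m := by
  have hmono : ∀ K ≤ N, ∑ m ∈ Finset.range K, c m ≤ ∑ m ∈ Finset.range N, c m := fun K hK =>
    Finset.sum_le_sum_of_subset_of_nonneg (Finset.range_subset_range.2 hK) fun _ _ _ => hc _
  rw [← Finset.sum_range_add_sum_Ico _ (Nat.succ_le_of_lt hi), two_mul]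
  refine add_le_add ?_ ?_
  · rw [← Finset.sum_range_reflect]
    refine le_trans (le_of_eq ?_) (hmono (i + 1) hi)
    refine Finset.sum_congr rfl fun j hj => ?_
    have := Finset.mem_range.1 hj
    congr 1
    lia
  · rw [Finset.sum_Ico_eq_sum_range]
    refine le_trans ?_ (hmono (N - i) (Nat.sub_le _ _))
    obtain ⟨K, rfl⟩ : ∃ K, N = i + 1 + K := ⟨N - (i + 1), by lia⟩
    rw [show i + 1 + K - i = K + 1 by lia, Finset.sum_range_succ',
      show i + 1 + K - i.succ = K by lia]
    refine (le_of_eq (Finset.sum_congr rfl fun j _ => ?_)).trans (le_add_of_nonneg_right (hc 0))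
    congr 1
    lia

section SecondMoment

variable {M : Type*} [MeasurableSpace M] {μ : Measure M} [IsProbabilityMeasure μ]

theorem integrable_of_mem_Icc {f : M → ℝ} (hf : Measurable f) {b : ℝ}
    (h : ∀ x, f x ∈ Set.Icc (-b) b) : Integrable f μ :=
  Integrable.of_bound hf.aestronglyMeasurable b (Eventually.of_forall fun x => abs_le.2 (h x))

theorem integral_centered_mul {F : M → M} (hF : MeasurePreserving F μ μ) {f : M → ℝ}
    (hf : Measurable f) (h01 : ∀ x, f x ∈ Set.Icc (0 : ℝ) 1) {i j : ℕ} (hij : i ≤ j) :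
    ∫ x, (f (F^[i] x) - ∫ y, f y ∂μ) * (f (F^[j] x) - ∫ y, f y ∂μ) ∂μ
      = ∫ x, f (F^[j - i] x) * f x ∂μ - (∫ y, f y ∂μ) ^ 2 := by
  set a := ∫ y, f y ∂μ with ha
  obtain ⟨n, rfl⟩ := Nat.exists_eq_add_of_le hij
  have hmeas : Measurable fun x => (f x - a) * (f (F^[n] x) - a) :=
    (hf.sub_const a).mul ((hf.comp (hF.iterate n).measurable).sub_const a)
  have hcomp : ∀ (g : M → ℝ) (m : ℕ), Measurable g → ∫ x, g (F^[m] x) ∂μ = ∫ x, g x ∂μ := by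
    intro g m hg
    have := (hF.iterate m).map_eq
    conv_rhs => rw [← this]
    exact (integral_map (hF.iterate m).measurable.aemeasurable hg.aestronglyMeasurable).symm
  have hshift := hcomp _ i hmeas
  simp_rw [← Function.iterate_add_apply, Nat.add_comm n i] at hshift
  rw [hshift, Nat.add_sub_cancel_left]
  have hi1 : Integrable f μ := integrable_of_mem_Icc hf (b := 1) fun x =>
    ⟨by linarith [(h01 x).1], (h01 x).2⟩
  have hi2 : Integrable (fun x => f (F^[n] x)) μ := (hF.iterate n).integrable_comp_of_integrable hi1
  have hi3 : Integrable (fun x => f (F^[n] x) * f x) μ :=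
    integrable_of_mem_Icc ((hf.comp (hF.iterate n).measurable).mul hf) (b := 1) fun x =>
      ⟨by nlinarith [(h01 x).1, (h01 (F^[n] x)).1],
        mul_le_one₀ (h01 _).2 (h01 x).1 (h01 x).2⟩
  have : ∀ x, (f x - a) * (f (F^[n] x) - a)
      = f (F^[n] x) * f x - a * f x - a * f (F^[n] x) + a ^ 2 := fun x => by ring
  simp_rw [this]
  have hi4 : Integrable (fun x => f (F^[n] x) * f x - a * f x) μ := hi3.sub (hi1.const_mul a)
  have hi5 : Integrable (fun x => f (F^[n] x) * f x - a * f x - a * f (F^[n] x)) μ :=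
    hi4.sub (hi2.const_mul a)
  rw [integral_add hi5 (integrable_const _), integral_sub hi4 (hi2.const_mul a),
    integral_sub hi3 (hi1.const_mul a), integral_const_mul, integral_const_mul, hcomp f n hf,
    ← ha]
  simp
  ring

/-- A quantitative Borel–Cantelli estimate: if the correlations of `f` are small, few orbits avoid
the support of `f` for a long time. -/
theorem measureReal_forall_eq_zero_le {F : M → M} (hF : MeasurePreserving F μ μ) {f : M → ℝ}
    (hf : Measurable f) (h01 : ∀ x, f x ∈ Set.Icc (0 : ℝ) 1) {c : ℕ → ℝ}
    (hc : ∀ n, |∫ x, f (F^[n] x) * f x ∂μ - (∫ y, f y ∂μ) ^ 2| ≤ c n) (N : ℕ) :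
    (N * ∫ y, f y ∂μ) ^ 2 * μ.real {x | ∀ n ∈ Finset.Icc 1 N, f (F^[n] x) = 0}
      ≤ N * (2 * ∑ m ∈ Finset.range N, c m) := by
  set a := ∫ y, f y ∂μ with ha
  have hc0 : ∀ n, 0 ≤ c n := fun n => (abs_nonneg _).trans (hc n)
  have ha0 : 0 ≤ a := integral_nonneg fun x => (h01 x).1
  have hfm : ∀ n, Measurable fun x => f (F^[n] x) := fun n => hf.comp (hF.iterate n).measurable
  have hint : ∀ i j, Integrable (fun x => (f (F^[i] x) - a) * (f (F^[j] x) - a)) μ := fun i j =>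
    Integrable.of_bound (((hfm i).sub_const a).mul ((hfm j).sub_const a)).aestronglyMeasurable
      ((1 + a) * (1 + a)) (Eventually.of_forall fun x => by
        rw [norm_mul]
        refine mul_le_mul ?_ ?_ (norm_nonneg _) (by positivity) <;>
        · rw [Real.norm_eq_abs, abs_le]
          constructor <;> linarith [(h01 (F^[i] x)).1, (h01 (F^[i] x)).2, (h01 (F^[j] x)).1,
            (h01 (F^[j] x)).2])
  set S : M → ℝ := fun x => ∑ i ∈ Finset.range N, (f (F^[i + 1] x) - a) with hS
  have hSq : ∀ x, S x ^ 2 = ∑ i ∈ Finset.range N, ∑ j ∈ Finset.range N,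
      (f (F^[i + 1] x) - a) * (f (F^[j + 1] x) - a) := fun x => by
    rw [sq, hS, Finset.sum_mul_sum]
  have hle : ∀ i j, ∫ x, (f (F^[i + 1] x) - a) * (f (F^[j + 1] x) - a) ∂μ
      ≤ c ((i - j) + (j - i)) := by
    intro i j
    rcases le_total i j with hij | hij
    · rw [integral_centered_mul hF hf h01 (Nat.succ_le_succ hij)]
      refine (le_abs_self _).trans ((hc _).trans (le_of_eq ?_))
      congr 1
      lia
    · simp_rw [mul_comm (f (F^[i + 1] _) - a)]
      rw [integral_centered_mul hF hf h01 (Nat.succ_le_succ hij)]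
      refine (le_abs_self _).trans ((hc _).trans (le_of_eq ?_))
      congr 1
      lia
  have hvar : ∫ x, S x ^ 2 ∂μ ≤ N * (2 * ∑ m ∈ Finset.range N, c m) := by
    simp_rw [hSq]
    rw [integral_finsetSum _ fun i _ => integrable_finsetSum _ fun j _ => hint _ _]
    simp_rw [integral_finsetSum (Finset.range N) fun j _ => hint (_ + 1) (j + 1)]
    calc _ ≤ ∑ i ∈ Finset.range N, ∑ j ∈ Finset.range N, c ((i - j) + (j - i)) :=
          Finset.sum_le_sum fun i _ => Finset.sum_le_sum fun j _ => hle i j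
      _ ≤ ∑ i ∈ Finset.range N, 2 * ∑ m ∈ Finset.range N, c m :=
          Finset.sum_le_sum fun i hi => sum_range_natDist_le hc0 (Finset.mem_range.1 hi)
      _ = _ := by simp
  have hSint : Integrable (fun x => S x ^ 2) μ := by
    simp_rw [hSq]
    exact integrable_finsetSum _ fun i _ => integrable_finsetSum _ fun j _ => hint _ _
  refine le_trans ?_ ((mul_meas_ge_le_integral_of_nonneg
    (Eventually.of_forall fun x => sq_nonneg (S x)) hSint ((N * a) ^ 2)).trans hvar)
  refine mul_le_mul_of_nonneg_left (measureReal_mono fun x hx => ?_) (sq_nonneg _)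
  have : S x = -(N * a) := by
    rw [hS]
    dsimp only
    rw [Finset.sum_congr rfl fun i hi => by
      rw [hx (i + 1) (Finset.mem_Icc.2 ⟨by lia, by have := Finset.mem_range.1 hi; lia⟩)]]
    simp
  simp only [Set.mem_ofPred_eq]
  rw [this, neg_sq]

/-- Both terms lie in `[0, ∫ f]`. This serves for short times, where decay is useless against the
large Lipschitz constant of a bump. -/
theorem abs_correlation_le {μ : Measure M} [IsProbabilityMeasure μ] {F : M → M}
    (hF : MeasurePreserving F μ μ) {f : M → ℝ} (hf : Measurable f)
    (h01 : ∀ x, f x ∈ Set.Icc (0 : ℝ) 1) (n : ℕ) :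
    |∫ x, f (F^[n] x) * f x ∂μ - (∫ y, f y ∂μ) ^ 2| ≤ ∫ y, f y ∂μ := by
  have hi1 : Integrable f μ := integrable_of_mem_Icc hf (b := 1) fun x =>
    ⟨by linarith [(h01 x).1], (h01 x).2⟩
  have hi3 : Integrable (fun x => f (F^[n] x) * f x) μ :=
    integrable_of_mem_Icc ((hf.comp (hF.iterate n).measurable).mul hf) (b := 1) fun x =>
      ⟨by nlinarith [(h01 x).1, (h01 (F^[n] x)).1],
        mul_le_one₀ (h01 _).2 (h01 x).1 (h01 x).2⟩
  have h0 : 0 ≤ ∫ x, f (F^[n] x) * f x ∂μ :=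
    integral_nonneg fun x => mul_nonneg (h01 _).1 (h01 x).1
  have h1 : ∫ x, f (F^[n] x) * f x ∂μ ≤ ∫ y, f y ∂μ :=
    integral_mono hi3 hi1 fun x => mul_le_of_le_one_left (h01 x).1 (h01 _).2
  have h2 : 0 ≤ ∫ y, f y ∂μ := integral_nonneg fun x => (h01 x).1
  have h3 : ∫ y, f y ∂μ ≤ 1 := by
    simpa using integral_mono hi1 (integrable_const (1 : ℝ)) fun x => (h01 x).2
  rw [abs_le]
  constructor <;> nlinarith

end SecondMoment

/-! ### The upper bound for hitting times -/

section Upper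

variable {M : Type*} [PseudoMetricSpace M] [MeasurableSpace M]

/-- Exponential decay of the autocorrelations of Lipschitz observables with values in `[0, 1]`. -/
def LipschitzDecay (μ : Measure M) (F : M → M) : Prop :=
  ∃ D ≥ (0 : ℝ), ∃ ρ ∈ Set.Ioo (0 : ℝ) 1, ∀ (f : M → ℝ) (l : ℝ≥0), LipschitzWith l f →
    (∀ x, f x ∈ Set.Icc (0 : ℝ) 1) → ∀ n : ℕ,
      |∫ x, f (F^[n] x) * f x ∂μ - (∫ x, f x ∂μ) ^ 2| ≤ D * (1 + l) * ρ ^ n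

/-- A Lipschitz function equal to `1` on the ball of radius `2⁻¹ ^ (k + 1)` and supported in the
ball of radius `2⁻¹ ^ k`. -/
def bump (x₀ : M) (k : ℕ) (x : M) : ℝ := max 0 (min 1 (2 - 2 ^ (k + 1) * dist x x₀))

omit [MeasurableSpace M] in
theorem lipschitzWith_bump (x₀ : M) (k : ℕ) : LipschitzWith (2 ^ (k + 1)) (bump x₀ k) := by
  refine LipschitzWith.const_max (LipschitzWith.const_min ?_ 1) 0
  refine LipschitzWith.of_dist_le_mul fun x y => ?_
  have := abs_dist_sub_le x y x₀
  rw [Real.dist_eq, show 2 - 2 ^ (k + 1) * dist x x₀ - (2 - 2 ^ (k + 1) * dist y x₀)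
    = -(2 ^ (k + 1) * (dist x x₀ - dist y x₀)) by ring, abs_neg, abs_mul,
    abs_of_pos (by positivity : (0 : ℝ) < 2 ^ (k + 1))]
  push_cast
  gcongr

end Upper

section Upper

variable {M : Type*} [PseudoMetricSpace M]

theorem bump_mem_Icc (x₀ : M) (k : ℕ) (x : M) : bump x₀ k x ∈ Set.Icc (0 : ℝ) 1 :=
  ⟨le_max_left _ _, max_le zero_le_one (min_le_left _ _)⟩

theorem bump_eq_one {x₀ : M} {k : ℕ} {x : M} (hx : x ∈ Metric.closedBall x₀ ((1 / 2) ^ (k + 1))) :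
    bump x₀ k x = 1 := by
  have h := mul_le_mul_of_nonneg_left (Metric.mem_closedBall.1 hx)
    (by positivity : (0 : ℝ) ≤ 2 ^ (k + 1))
  rw [← mul_pow, show (2 : ℝ) * (1 / 2) = 1 by norm_num, one_pow] at h
  rw [bump, min_eq_left (by linarith), max_eq_right zero_le_one]

theorem mem_closedBall_of_bump_ne_zero {x₀ : M} {k : ℕ} {x : M} (hx : bump x₀ k x ≠ 0) :
    x ∈ Metric.closedBall x₀ ((1 / 2) ^ k) := by
  by_contra! h
  refine hx (max_eq_left (min_le_of_right_le ?_))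
  rw [Metric.mem_closedBall, not_le] at h
  have h := mul_lt_mul_of_pos_left h (by positivity : (0 : ℝ) < 2 ^ (k + 1))
  rw [pow_succ, mul_right_comm, ← mul_pow, show (2 : ℝ) * (1 / 2) = 1 by norm_num, one_pow] at h
  rw [pow_succ]
  linarith

variable [MeasurableSpace M] [OpensMeasurableSpace M]

theorem measureReal_closedBall_le_integral_bump (μ : Measure M) [IsProbabilityMeasure μ] (x₀ : M)
    (k : ℕ) : μ.real (Metric.closedBall x₀ ((1 / 2) ^ (k + 1))) ≤ ∫ x, bump x₀ k x ∂μ := by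
  have hint : Integrable (bump x₀ k) μ :=
    integrable_of_mem_Icc (lipschitzWith_bump x₀ k).continuous.measurable (b := 1) fun x =>
      ⟨by linarith [(bump_mem_Icc x₀ k x).1], (bump_mem_Icc x₀ k x).2⟩
  have hB : MeasurableSet (Metric.closedBall x₀ ((1 / 2 : ℝ) ^ (k + 1))) :=
    Metric.isClosed_closedBall.measurableSet
  rw [← integral_indicator_one hB]
  refine integral_mono ((integrable_const (1 : ℝ)).indicator hB) hint fun x => ?_
  refine Set.indicator_apply_le' (fun hx => ?_) fun _ => (bump_mem_Icc x₀ k x).1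
  rw [bump_eq_one hx, Pi.one_apply]

/-- The bound `min a (B ρ ^ j)` for correlations, summed. -/
theorem sum_cutoff_le {a B σ : ℝ} (ha : 0 ≤ a) (hB : 0 ≤ B) (hσ : σ ∈ Set.Ioo (0 : ℝ) 1)
    (J N : ℕ) :
    ∑ j ∈ Finset.range N, ((if j < J then a else 0) + B * σ ^ J * σ ^ j)
      ≤ J * a + B * σ ^ J / (1 - σ) := by
  rw [Finset.sum_add_distrib]
  refine add_le_add ?_ ?_
  · rw [← Finset.sum_filter, Finset.sum_const, nsmul_eq_mul]
    refine mul_le_mul_of_nonneg_right ?_ ha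
    have : ((Finset.range N).filter (· < J)).card ≤ (Finset.range J).card :=
      Finset.card_le_card fun j hj => Finset.mem_range.2 (Finset.mem_filter.1 hj).2
    rw [Finset.card_range] at this
    exact_mod_cast this
  · rw [← Finset.mul_sum, div_eq_mul_inv]
    refine mul_le_mul_of_nonneg_left ?_ (mul_nonneg hB (pow_nonneg hσ.1.le _))
    rw [← tsum_geometric_of_lt_one hσ.1.le hσ.2]
    exact (summable_geometric_of_lt_one hσ.1.le hσ.2).sum_le_tsum _
      fun _ _ => pow_nonneg hσ.1.le _

/-- If `a ≥ 2 ^ (-(k + 1) s)` is the mean of the bump function at scale `2⁻¹ ^ k`, the orbits that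
avoid its support up to time `2 ^ (k u)` have measure at most `(A k + B) 2 ^ (k (s - u))`. -/
theorem LipschitzDecay.measureReal_avoid_le {μ : Measure M} [IsProbabilityMeasure μ] {F : M → M}
    (hF : MeasurePreserving F μ μ) (hdec : LipschitzDecay μ F) (x₀ : M) (s u : ℝ) :
    ∃ A ≥ (0 : ℝ), ∃ B ≥ (0 : ℝ), ∀ k : ℕ,
      (2 : ℝ) ^ (-((k + 1 : ℕ) * s)) ≤ ∫ x, bump x₀ k x ∂μ →
      μ.real {x | ∀ n ∈ Finset.Icc 1 ⌈(2 : ℝ) ^ (k * u)⌉₊, bump x₀ k (F^[n] x) = 0}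
        ≤ (A * k + B) * (2 : ℝ) ^ (k * (s - u)) := by
  obtain ⟨D, hD, ρ, hρ, hdec⟩ := hdec
  -- Of the two factors in `ρ ^ n = σ ^ n * σ ^ n`, one makes the tail small and the other keeps it
  -- summable.
  set σ := √ρ with hσdef
  have hσ : σ ∈ Set.Ioo (0 : ℝ) 1 :=
    ⟨Real.sqrt_pos.2 hρ.1, (Real.sqrt_lt' one_pos).2 (by simpa using hρ.2)⟩
  have hσρ : ∀ n, ρ ^ n = σ ^ n * σ ^ n := fun n => by
    rw [← mul_pow, Real.mul_self_sqrt hρ.1.le]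
  -- Then `σ ^ (m * k) ≤ 2 ^ (-k) * 2 ^ (-(k * s))`: the first factor cancels the Lipschitz constant
  -- `2 ^ (k + 1)`, the second is comparable to the lower bound for `a`.
  obtain ⟨m, hm⟩ := exists_pow_lt_of_lt_one (Real.rpow_pos_of_pos two_pos (-1 - s)) hσ.2
  have h1σ : 0 < 1 - σ := by linarith [hσ.2]
  set E := 3 * D / (1 - σ) with hE
  have hE0 : 0 ≤ E := by positivity
  refine ⟨2 * m * 2 ^ s, by positivity, 2 * (E * 2 ^ s) * 2 ^ s, by positivity, fun k hk => ?_⟩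
  set a := ∫ x, bump x₀ k x ∂μ with ha
  set N := ⌈(2 : ℝ) ^ (k * u)⌉₊
  have hNle : (2 : ℝ) ^ (k * u) ≤ N := Nat.le_ceil _
  have hN : (0 : ℝ) < N := lt_of_lt_of_le (by positivity) hNle
  have ha0 : 0 < a := lt_of_lt_of_le (by positivity) hk
  have hfm : Measurable (bump x₀ k) := (lipschitzWith_bump x₀ k).continuous.measurable
  have hc : ∀ n, |∫ x, bump x₀ k (F^[n] x) * bump x₀ k x ∂μ - (∫ y, bump x₀ k y ∂μ) ^ 2|
      ≤ (if n < m * k then a else 0) + D * (1 + 2 ^ (k + 1)) * σ ^ (m * k) * σ ^ n := by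
    intro n
    split_ifs with hn
    · refine (abs_correlation_le hF hfm (bump_mem_Icc x₀ k) n).trans (le_add_of_nonneg_right ?_)
      have := hσ.1
      positivity
    · rw [zero_add]
      have h := hdec _ _ (lipschitzWith_bump x₀ k) (bump_mem_Icc x₀ k) n
      rw [hσρ, ← mul_assoc] at h
      push_cast at h
      refine h.trans (mul_le_mul_of_nonneg_right (mul_le_mul_of_nonneg_left ?_ (by positivity))
        (pow_nonneg hσ.1.le _))
      exact pow_le_pow_of_le_one hσ.1.le hσ.2.le (not_lt.1 hn)
  have hmain := measureReal_forall_eq_zero_le hF hfm (bump_mem_Icc x₀ k) hc N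
  set P := μ.real {x | ∀ n ∈ Finset.Icc 1 N, bump x₀ k (F^[n] x) = 0}
  have hP0 : 0 ≤ P := measureReal_nonneg
  have hsum := sum_cutoff_le ha0.le (by positivity : 0 ≤ D * (1 + 2 ^ (k + 1))) hσ (m * k) N
  have htail : D * (1 + 2 ^ (k + 1)) * σ ^ (m * k) / (1 - σ) ≤ E * 2 ^ s * a := by
    have h1 : (1 : ℝ) + 2 ^ (k + 1) ≤ 3 * 2 ^ k := by
      have : (1 : ℝ) ≤ 2 ^ k := one_le_pow₀ (by norm_num)
      rw [pow_succ]
      linarith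
    have h2 : σ ^ (m * k) ≤ (2 : ℝ) ^ (k * (-1 - s)) := by
      rw [pow_mul, two_rpow_eq]
      exact pow_le_pow_left₀ (pow_nonneg hσ.1.le _) hm.le k
    have h3 : (2 : ℝ) ^ k * 2 ^ (k * (-1 - s)) = 2 ^ s * 2 ^ (-((k + 1 : ℕ) * s)) := by
      rw [← Real.rpow_natCast, ← Real.rpow_add two_pos, ← Real.rpow_add two_pos]
      congr 1
      push_cast
      ring
    calc D * (1 + 2 ^ (k + 1)) * σ ^ (m * k) / (1 - σ)
        ≤ D * (3 * 2 ^ k) * 2 ^ (k * (-1 - s)) / (1 - σ) := by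
          gcongr
      _ = E * (2 ^ k * 2 ^ (k * (-1 - s))) := by rw [hE]; ring
      _ = E * 2 ^ s * 2 ^ (-((k + 1 : ℕ) * s)) := by rw [h3, mul_assoc]
      _ ≤ _ := mul_le_mul_of_nonneg_left hk (by positivity)
  have hlin : N * a * P ≤ 2 * (m * k + E * 2 ^ s) := by
    have h : (N * a) * (N * a * P) ≤ (N * a) * (2 * (m * k + E * 2 ^ s)) := by
      push_cast at hsum
      calc (N * a) * (N * a * P) = (N * a) ^ 2 * P := by ring
        _ ≤ N * (2 * (m * k * a + E * 2 ^ s * a)) := hmain.trans (by gcongr; linarith)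
        _ = _ := by ring
    exact le_of_mul_le_mul_left h (mul_pos hN ha0)
  have hlow : (2 : ℝ) ^ (k * (u - s) - s) ≤ N * a := by
    refine le_trans (le_of_eq ?_) (mul_le_mul hNle hk (by positivity) hN.le)
    rw [← Real.rpow_add two_pos]
    congr 1
    push_cast
    ring
  have hfin : (2 : ℝ) ^ (k * (u - s) - s) * P ≤ 2 * (m * k + E * 2 ^ s) :=
    (mul_le_mul_of_nonneg_right hlow hP0).trans hlin
  have hinv : (2 : ℝ) ^ (k * (u - s) - s) * (2 ^ s * 2 ^ (k * (s - u))) = 1 := by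
    rw [← Real.rpow_add two_pos, ← Real.rpow_add two_pos, ← Real.rpow_zero 2]
    congr 1
    ring
  calc P = ((2 : ℝ) ^ (k * (u - s) - s) * P) * (2 ^ s * 2 ^ (k * (s - u))) := by
        rw [mul_right_comm, hinv, one_mul]
    _ ≤ (2 * (m * k + E * 2 ^ s)) * (2 ^ s * 2 ^ (k * (s - u))) :=
        mul_le_mul_of_nonneg_right hfin (by positivity)
    _ = _ := by ring

theorem ae_eventually_log_hittingTime_lt {μ : Measure M} [IsProbabilityMeasure μ] {F : M → M}
    (hF : MeasurePreserving F μ μ) (hdec : LipschitzDecay μ F) {x₀ : M} {d : EReal}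
    (hd : HasLocalDim μ x₀ d) {t : ℝ} (ht : d < t) :
    ∀ᵐ x ∂μ, ∀ᶠ r : ℝ in 𝓝[>] 0,
      ENNReal.log ((hittingTime F r x x₀ : ℕ∞) : ℝ≥0∞) / ((-Real.log r : ℝ) : EReal) < t := by
  obtain ⟨s, hds, hst⟩ := EReal.lt_iff_exists_real_btwn.1 ht
  have hst : s < t := by exact_mod_cast hst
  have hs0 : 0 < s := by exact_mod_cast hd.nonneg.trans_lt hds
  obtain ⟨u, hsu, hut⟩ := exists_between hst
  obtain ⟨A, hA, B, hB, hAB⟩ := hdec.measureReal_avoid_le hF x₀ s u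
  have hsummable : Summable fun k : ℕ => (A * k + B) * (2 : ℝ) ^ (k * (s - u)) := by
    have hq : (2 : ℝ) ^ (s - u) < 1 := Real.rpow_lt_one_of_one_lt_of_neg one_lt_two (by linarith)
    have h1 := summable_pow_mul_geometric_of_norm_lt_one 1
      (by rwa [Real.norm_of_nonneg (by positivity)] : ‖(2 : ℝ) ^ (s - u)‖ < 1)
    refine ((h1.mul_left A).add ((summable_two_rpow (by linarith : s - u < 0)).mul_left B)).congr
      fun k => ?_
    rw [two_rpow_eq]
    ring
  have key := ae_eventually_notMem_of_summable (μ := μ)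
    (A := fun k => {x | ∀ n ∈ Finset.Icc 1 ⌈(2 : ℝ) ^ (k * u)⌉₊, bump x₀ k (F^[n] x) = 0})
    hsummable (fun k => by positivity) ?_
  · filter_upwards [key] with x hx
    refine eventually_div_neg_log_lt (antitone_log_hittingTime F x x₀) hut (by linarith) ?_
    filter_upwards [hx] with k hk
    simp only [not_forall] at hk
    obtain ⟨n, hn, hne⟩ := hk
    rw [Finset.mem_Icc] at hn
    have h1 := ENat.toENNReal_le.2
      (hittingTime_le (F := F) hn.1 hn.2 (mem_closedBall_of_bump_ne_zero hne))
    rw [← log_ofReal_two_rpow]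
    refine ENNReal.log_le_log (h1.trans ?_)
    rw [ENat.toENNReal_coe, ← ENNReal.ofReal_natCast]
    refine ENNReal.ofReal_le_ofReal ?_
    rw [Real.rpow_add two_pos, Real.rpow_one]
    have h2 : (1 : ℝ) ≤ 2 ^ (k * u) :=
      Real.one_le_rpow one_le_two (mul_nonneg (Nat.cast_nonneg _) (by linarith))
    linarith [(Nat.ceil_lt_add_one (by positivity : (0 : ℝ) ≤ 2 ^ (k * u))).le]
  -- The shift is needed because the mean of the bump at scale `k` is bounded below by the measure
  -- of the ball of radius `2⁻ᵏ⁻¹`.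
  · filter_upwards [(tendsto_add_atTop_nat 1).eventually (hd.eventually_le_measure hds)] with k hk
    refine (ENNReal.le_ofReal_iff_toReal_le (measure_ne_top _ _) (by positivity)).2 (hAB k ?_)
    refine le_trans ?_ (measureReal_closedBall_le_integral_bump μ x₀ k)
    exact (ENNReal.ofReal_le_iff_le_toReal (measure_ne_top _ _)).1 hk

/-- The logarithm law for hitting times. -/
theorem LipschitzDecay.tendsto_log_hittingTime {μ : Measure M} [IsProbabilityMeasure μ]
    {F : M → M} (hF : MeasurePreserving F μ μ) (hdec : LipschitzDecay μ F) {x₀ : M} {d : EReal}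
    (hd : HasLocalDim μ x₀ d) :
    ∀ᵐ x ∂μ, Tendsto (fun r : ℝ =>
      ENNReal.log ((hittingTime F r x x₀ : ℕ∞) : ℝ≥0∞) / ((-Real.log r : ℝ) : EReal))
      (𝓝[>] 0) (𝓝 d) := by
  -- Rational thresholds keep the union of exceptional null sets countable.
  have hlow : ∀ᵐ x ∂μ, ∀ q : ℚ, ((q : ℝ) : EReal) < d → ∀ᶠ r : ℝ in 𝓝[>] 0, ((q : ℝ) : EReal) <
      ENNReal.log ((hittingTime F r x x₀ : ℕ∞) : ℝ≥0∞) / ((-Real.log r : ℝ) : EReal) := by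
    refine ae_all_iff.2 fun q => ?_
    by_cases hq : ((q : ℝ) : EReal) < d
    · filter_upwards [ae_eventually_lt_log_hittingTime hF hd hq] with x hx _ using hx
    · exact Eventually.of_forall fun x h => absurd h hq
  have hup : ∀ᵐ x ∂μ, ∀ q : ℚ, d < ((q : ℝ) : EReal) → ∀ᶠ r : ℝ in 𝓝[>] 0,
      ENNReal.log ((hittingTime F r x x₀ : ℕ∞) : ℝ≥0∞) / ((-Real.log r : ℝ) : EReal)
        < ((q : ℝ) : EReal) := by
    refine ae_all_iff.2 fun q => ?_
    by_cases hq : d < ((q : ℝ) : EReal)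
    · filter_upwards [ae_eventually_log_hittingTime_lt hF hdec hd hq] with x hx _ using hx
    · exact Eventually.of_forall fun x h => absurd h hq
  filter_upwards [hlow, hup] with x hx1 hx2
  refine tendsto_order.2 ⟨fun a ha => ?_, fun a ha => ?_⟩
  · obtain ⟨q, haq, hqd⟩ := EReal.lt_iff_exists_rat_btwn.1 ha
    exact (hx1 q hqd).mono fun r hr => haq.trans hr
  · obtain ⟨q, hdq, hqa⟩ := EReal.lt_iff_exists_rat_btwn.1 ha
    exact (hx2 q hdq).mono fun r hr => hr.trans hqa

end Upper

/-! ### Decay of correlations for the fibred map -/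

instance isProbabilityMeasure_leb : IsProbabilityMeasure leb := by
  refine ⟨?_⟩
  rw [leb, comap_subtype_coe_apply measurableSet_Icc, Set.image_univ, Subtype.range_coe,
    Real.volume_Icc]
  norm_num

/-- The midpoint of the interval. -/
def mid : I := ⟨0, by norm_num, by norm_num⟩

theorem dist_mid_le (y : I) : dist y mid ≤ 1 := by
  rw [Subtype.dist_eq, Real.dist_eq, abs_le]
  have := y.2
  simp only [Set.mem_Icc] at this
  constructor <;> simp only [mid] <;> linarith

theorem fst_iterate_fibredMap (T : I → I) (G : I → I → I) (n : ℕ) (p : Square) :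
    ((fibredMap T G)^[n] p).1 = T^[n] p.1 := by
  induction n with
  | zero => rfl
  | succ n ih => rw [Function.iterate_succ_apply', Function.iterate_succ_apply', ← ih]; rfl

theorem dist_iterate_fibredMap_le {T : I → I} {G : I → I → I} {c : ℝ≥0}
    (hG : ∀ x : I, LipschitzWith c (G x)) (n : ℕ) (p q : Square) (hpq : p.1 = q.1) :
    dist ((fibredMap T G)^[n] p) ((fibredMap T G)^[n] q) ≤ (c : ℝ) ^ n * dist p.2 q.2 := by
  have hfst : ((fibredMap T G)^[n] p).1 = ((fibredMap T G)^[n] q).1 := by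
    rw [fst_iterate_fibredMap, fst_iterate_fibredMap, hpq]
  suffices h : dist ((fibredMap T G)^[n] p).2 ((fibredMap T G)^[n] q).2 ≤ c ^ n * dist p.2 q.2 by
    rw [Prod.dist_eq, hfst, dist_self]
    exact max_le (by positivity) h
  induction n with
  | zero => simp
  | succ n ih =>
    have hfst' : ((fibredMap T G)^[n] p).1 = ((fibredMap T G)^[n] q).1 := by
      rw [fst_iterate_fibredMap, fst_iterate_fibredMap, hpq]
    rw [Function.iterate_succ_apply', Function.iterate_succ_apply', pow_succ', mul_assoc]
    change dist (G _ _) (G _ _) ≤ _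
    rw [hfst']
    exact ((hG _).dist_le_mul _ _).trans (mul_le_mul_of_nonneg_left (ih hfst') c.2)

section Density

variable {μ : Measure Square} {f : Square → ℝ} {h : I → ℝ}

theorem IsMarginalDensity.integral_eq (hh : IsMarginalDensity μ f h) :
    ∫ x, h x ∂leb = ∫ p, f p ∂μ := by
  simpa using (hh.2 Set.univ MeasurableSet.univ).symm

theorem IsMarginalDensity.ae_nonneg (hh : IsMarginalDensity μ f h) (hf : ∀ p, 0 ≤ f p) :
    0 ≤ᵐ[leb] h :=
  ae_nonneg_of_forall_setIntegral_nonneg hh.1 fun A hA _ => by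
    rw [← hh.2 A hA]
    exact integral_nonneg hf

/-- For `f ≥ 0` the density identity on sets is an equality of positive measures on `I`, against
which `φ` is integrated. -/
theorem IsMarginalDensity.integral_mul_eq (hh : IsMarginalDensity μ f h) (hf : ∀ p, 0 ≤ f p)
    (hfm : Measurable f) (hfi : Integrable f μ) {φ : I → ℝ} (hφ : Measurable φ) :
    ∫ p, φ p.1 * f p ∂μ = ∫ x, φ x * h x ∂leb := by
  have hmeas : (μ.withDensity fun p => ENNReal.ofReal (f p)).map Prod.fst
      = leb.withDensity fun x => ENNReal.ofReal (h x) := by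
    ext A hA
    rw [Measure.map_apply measurable_fst hA, withDensity_apply _ (measurable_fst hA),
      withDensity_apply _ hA, ← ofReal_integral_eq_lintegral_ofReal hfi.integrableOn
        (Eventually.of_forall hf), ← ofReal_integral_eq_lintegral_ofReal hh.1.integrableOn
        (ae_restrict_of_ae (hh.ae_nonneg hf)), hh.2 A hA]
  have h1 : ∫ p, φ p.1 * f p ∂μ
      = ∫ x, φ x ∂((μ.withDensity fun p => ENNReal.ofReal (f p)).map Prod.fst) := by
    rw [integral_map measurable_fst.aemeasurable hφ.aestronglyMeasurable,
      integral_withDensity_eq_integral_toReal_smul hfm.ennreal_ofReal (by simp)]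
    refine integral_congr_ae (Eventually.of_forall fun p => ?_)
    simp only [ENNReal.toReal_ofReal (hf p), smul_eq_mul, mul_comm]
  have h2 : ∫ x, φ x * h x ∂leb = ∫ x, φ x ∂(leb.withDensity fun x => ENNReal.ofReal (h x)) := by
    rw [integral_withDensity_eq_integral_toReal_smul₀ hh.1.aemeasurable.ennreal_ofReal (by simp)]
    refine integral_congr_ae ((hh.ae_nonneg hf).mono fun x hx => ?_)
    simp only [ENNReal.toReal_ofReal hx, smul_eq_mul, mul_comm]
  rw [h1, h2, hmeas]

end Density

theorem abs_integral_sub_le {α : Type*} [MeasurableSpace α] {μ : Measure α}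
    [IsProbabilityMeasure μ] {f g : α → ℝ} (hf : Integrable f μ) (hg : Integrable g μ) {ε : ℝ}
    (h : ∀ x, |f x - g x| ≤ ε) : |∫ x, f x ∂μ - ∫ x, g x ∂μ| ≤ ε := by
  rw [← integral_sub hf hg]
  simpa using norm_integral_le_of_norm_le_const (μ := μ) (f := fun x => f x - g x)
    (Eventually.of_forall h)

/-- The decay of correlations for the fibred map in terms of a splitting `k + n` of the time:
`k` steps are spent on the contraction along the fibres, `n` steps on the mixing of the base. -/
theorem IsLorenzLike.exists_correlation_le {T : I → I} {G : I → I → I} {μ : Measure Square}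
    (hF : IsLorenzLike T G μ) :
    ∃ D ≥ (0 : ℝ), ∃ γ ∈ Set.Ioo (0 : ℝ) 1, ∀ (f : Square → ℝ) (l : ℝ≥0), LipschitzWith l f →
      (∀ x, f x ∈ Set.Icc (0 : ℝ) 1) → ∀ k n : ℕ,
        |∫ x, f ((fibredMap T G)^[k + n] x) * f x ∂μ - (∫ x, f x ∂μ) ^ 2|
          ≤ D * (1 + l) * (γ ^ k + γ ^ n) := by
  have := hF.isProbabilityMeasure
  have hinv := hF.invariant
  obtain ⟨C, hC, θ, hθ, hdecay⟩ := hF.decay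
  obtain ⟨c, hc1, hG⟩ := hF.contraction
  obtain ⟨K, hK⟩ := hF.regular
  have hγc : (c : ℝ) ≤ max (c : ℝ) (Real.exp (-θ)) := le_max_left _ _
  have hγθ : Real.exp (-θ) ≤ max (c : ℝ) (Real.exp (-θ)) := le_max_right _ _
  have hγ1 : max (c : ℝ) (Real.exp (-θ)) < 1 :=
    max_lt (by exact_mod_cast hc1) (by simpa using hθ)
  set γ := max (c : ℝ) (Real.exp (-θ))
  have hγ0 : 0 < γ := (Real.exp_pos _).trans_le hγθ
  refine ⟨2 + C * (1 + K), by positivity, γ, ⟨hγ0, hγ1⟩, fun f l hl h01 k n => ?_⟩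
  set F := fibredMap T G
  obtain ⟨h, hh, hvar⟩ := hK f l hl
  have hfm : Measurable f := hl.continuous.measurable
  have bdd : ∀ {α : Type} [MeasurableSpace α] {ν : Measure α} [IsProbabilityMeasure ν] {g : α → ℝ},
      Measurable g → (∀ x, g x ∈ Set.Icc (0 : ℝ) 1) → Integrable g ν := fun hg hg1 =>
    integrable_of_mem_Icc hg (b := 1) fun x => ⟨by linarith [(hg1 x).1], (hg1 x).2⟩
  have hfi : Integrable f μ := bdd hfm h01
  have ha0 : 0 ≤ ∫ p, f p ∂μ := integral_nonneg fun p => (h01 p).1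
  have ha1 : ∫ p, f p ∂μ ≤ 1 := by
    simpa using integral_mono hfi (integrable_const (1 : ℝ)) fun p => (h01 p).2
  set a := ∫ p, f p ∂μ with ha
  have hvar' : eVariationOn h Set.univ ≤ ENNReal.ofReal (K * (1 + l)) := by
    refine hvar.trans ?_
    rw [ENNReal.ofReal_mul (NNReal.coe_nonneg K),
      ENNReal.ofReal_add zero_le_one (NNReal.coe_nonneg l), ENNReal.ofReal_one, ENNReal.ofReal_coe_nnreal, ENNReal.ofReal_coe_nnreal]
    gcongr
    refine iSup_le fun p => ?_
    rw [← ofReal_norm, ENNReal.ofReal_le_one, Real.norm_of_nonneg (h01 p).1]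
    exact (h01 p).2
  have hBV : BoundedVariationOn h Set.univ := ne_top_of_le_ne_top ENNReal.ofReal_ne_top hvar'
  have hnorm : bvNorm h ≤ 1 + K * (1 + l) := by
    refine add_le_add ?_ ?_
    · rw [integral_congr_ae ((hh.ae_nonneg fun p => (h01 p).1).mono fun x hx => abs_of_nonneg hx),
        hh.integral_eq]
      exact ha1
    · exact ENNReal.toReal_le_of_le_ofReal (by positivity) hvar'
  have hnorm0 : 0 ≤ bvNorm h :=
    add_nonneg (integral_nonneg fun x => abs_nonneg _) ENNReal.toReal_nonneg
  -- Measurability of `T` is read off from that of `F` on a horizontal line.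
  have hTm : Measurable T := by
    have : Measurable fun x : I => (F (x, mid)).1 :=
      measurable_fst.comp (hinv.measurable.comp measurable_prodMk_right)
    exact this
  set φ : I → ℝ := fun x => f (F^[k] (x, mid)) with hφ
  have hφm : Measurable φ := hfm.comp ((hinv.iterate k).measurable.comp measurable_prodMk_right)
  have hφ01 : ∀ x, φ x ∈ Set.Icc (0 : ℝ) 1 := fun x => h01 _
  have hclose : ∀ p, |f (F^[k] p) - φ p.1| ≤ l * (c : ℝ) ^ k := by
    intro p
    refine (hl.dist_le_mul _ _).trans (mul_le_mul_of_nonneg_left ?_ l.2)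
    refine (dist_iterate_fibredMap_le hG k p (p.1, mid) rfl).trans ?_
    exact mul_le_of_le_one_right (by positivity) (dist_mid_le _)
  have hmeas1 : Measurable fun p => f (F^[k + n] p) := hfm.comp (hinv.iterate _).measurable
  have hmeas2 : Measurable fun p : Square => φ (T^[n] p.1) :=
    hφm.comp ((hTm.iterate n).comp measurable_fst)
  have hprod : ∀ {u v : ℝ}, u ∈ Set.Icc (0 : ℝ) 1 → v ∈ Set.Icc (0 : ℝ) 1 →
      u * v ∈ Set.Icc (0 : ℝ) 1 := fun hu hv => ⟨mul_nonneg hu.1 hv.1, mul_le_one₀ hu.2 hv.1 hv.2⟩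
  -- Here `F^[k + n] = F^[k] ∘ F^[n]`, and `hclose` is used at the point `F^[n] p`.
  have step1 : |∫ p, f (F^[k + n] p) * f p ∂μ - ∫ p, φ (T^[n] p.1) * f p ∂μ|
      ≤ l * (c : ℝ) ^ k := by
    refine abs_integral_sub_le (bdd (hmeas1.mul hfm) fun p => hprod (h01 _) (h01 _))
      (bdd (hmeas2.mul hfm) fun p => hprod (hφ01 _) (h01 _)) fun p => ?_
    simp only [Pi.mul_apply]
    rw [← sub_mul, abs_mul, abs_of_nonneg (h01 p).1, Function.iterate_add_apply,
      ← fst_iterate_fibredMap T G]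
    exact (mul_le_of_le_one_right (abs_nonneg _) (h01 p).2).trans (hclose _)
  have step2 : ∫ p, φ (T^[n] p.1) * f p ∂μ = ∫ x, φ (T^[n] x) * h x ∂leb :=
    hh.integral_mul_eq (fun p => (h01 p).1) hfm hfi (hφm.comp (hTm.iterate n))
  -- The `L¹` observable is `φ`, bounded by `1` whatever its regularity; the BV observable is the
  -- density `h`.
  have step3 : |(∫ x, φ (T^[n] x) * h x ∂leb) - (∫ p, φ p.1 ∂μ) * a|
      ≤ C * (1 + K * (1 + l)) * Real.exp (-θ) ^ n := by
    have := hdecay φ hφm (bdd hφm hφ01) h hBV n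
    rw [integral_map measurable_fst.aemeasurable hφm.aestronglyMeasurable, hh.integral_eq] at this
    refine this.trans ?_
    have h1 : ∫ x, |φ x| ∂leb ≤ 1 := by
      simpa using integral_mono (μ := leb) (bdd hφm hφ01).abs (integrable_const (1 : ℝ)) fun x => by
        rw [abs_of_nonneg (hφ01 x).1]
        exact (hφ01 x).2
    rw [mul_comm (-θ), Real.exp_nat_mul]
    gcongr
    exact mul_le_of_le_one_right hC.le h1
  have step4 : |(∫ p, φ p.1 ∂μ) - a| ≤ l * (c : ℝ) ^ k := by
    have hshift : a = ∫ p, f (F^[k] p) ∂μ := by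
      rw [ha]
      conv_lhs => rw [← (hinv.iterate k).map_eq]
      exact integral_map (hinv.iterate k).measurable.aemeasurable hfm.aestronglyMeasurable
    rw [hshift, abs_sub_comm]
    exact abs_integral_sub_le (bdd (hfm.comp (hinv.iterate k).measurable) fun p => h01 _)
      (bdd (hφm.comp measurable_fst) fun p => hφ01 _) hclose
  have step5 : |(∫ p, φ p.1 ∂μ) * a - a ^ 2| ≤ l * (c : ℝ) ^ k := by
    rw [sq, ← sub_mul, abs_mul, abs_of_nonneg ha0]
    exact (mul_le_of_le_one_right (abs_nonneg _) ha1).trans step4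
  rw [← step2] at step3
  have htri := (abs_sub_le _ _ _).trans (add_le_add ((abs_sub_le _ _ _).trans
    (add_le_add step1 step3)) step5)
  refine htri.trans ?_
  have hck : (c : ℝ) ^ k ≤ γ ^ k := pow_le_pow_left₀ c.2 hγc k
  have hen : Real.exp (-θ) ^ n ≤ γ ^ n := pow_le_pow_left₀ (Real.exp_pos _).le hγθ n
  have hl0 : (0 : ℝ) ≤ l := l.2
  have hK0 : (0 : ℝ) ≤ K := K.2
  calc l * (c : ℝ) ^ k + C * (1 + K * (1 + l)) * Real.exp (-θ) ^ n + l * (c : ℝ) ^ k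
      ≤ l * γ ^ k + C * (1 + K * (1 + l)) * γ ^ n + l * γ ^ k := by gcongr
    _ ≤ (2 * (1 + l)) * γ ^ k + (C * (1 + K) * (1 + l)) * γ ^ n := by
      have h1 : C * (1 + K * (1 + l)) * γ ^ n ≤ C * (1 + K) * (1 + l) * γ ^ n := by
        refine mul_le_mul_of_nonneg_right ?_ (pow_nonneg hγ0.le _)
        rw [mul_assoc C]
        exact mul_le_mul_of_nonneg_left (by linarith) hC.le
      have h2 : l * γ ^ k + l * γ ^ k ≤ 2 * (1 + l) * γ ^ k := by
        have := pow_pos hγ0 k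
        nlinarith
      linarith
    _ ≤ _ := by
      have h1 : 0 ≤ C * (1 + K) * (1 + l) * γ ^ k := by positivity
      have h2 : 0 ≤ 2 * (1 + l) * γ ^ n := by positivity
      nlinarith

/-- Half of the time goes to the fibres and half to the base, so the rate becomes `√γ`. The division
by `√γ` in the constant pays for odd `n`. -/
theorem IsLorenzLike.lipschitzDecay {T : I → I} {G : I → I → I} {μ : Measure Square}
    (hF : IsLorenzLike T G μ) : LipschitzDecay μ (fibredMap T G) := by
  obtain ⟨D, hD, γ, ⟨hγ0, hγ1⟩, hdec⟩ := hF.exists_correlation_le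
  have hρ0 : 0 < √γ := Real.sqrt_pos.2 hγ0
  have hρ1 : √γ < 1 := (Real.sqrt_lt' one_pos).2 (by simpa using hγ1)
  refine ⟨D * 2 / √γ, by positivity, √γ, ⟨hρ0, hρ1⟩, fun f l hl h01 n => ?_⟩
  have h := hdec f l hl h01 (n / 2) (n - n / 2)
  rw [Nat.add_sub_cancel' (Nat.div_le_self n 2)] at h
  have h1 : γ ^ (n - n / 2) ≤ γ ^ (n / 2) := pow_le_pow_of_le_one hγ0.le hγ1.le (by lia)
  have h2 : γ ^ (n / 2) ≤ √γ ^ n / √γ := by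
    rw [le_div_iff₀ hρ0]
    have hsq : γ ^ (n / 2) = √γ ^ (2 * (n / 2)) := by rw [pow_mul, Real.sq_sqrt hγ0.le]
    rw [hsq, ← pow_succ]
    exact pow_le_pow_of_le_one hρ0.le hρ1.le (by lia)
  calc _ ≤ D * (1 + l) * (γ ^ (n / 2) + γ ^ (n - n / 2)) := h
    _ ≤ D * (1 + l) * (√γ ^ n / √γ + √γ ^ n / √γ) := by gcongr; exact h1.trans h2
    _ = _ := by ring

end LorenzLike

theorem corollary6p2 (T : LorenzLike.I → LorenzLike.I)
    (G : LorenzLike.I → LorenzLike.I → LorenzLike.I)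
    (μ : Measure LorenzLike.Square) (hF : LorenzLike.IsLorenzLike T G μ)
    (x₀ : LorenzLike.Square) (d : EReal) (hd : LorenzLike.HasLocalDim μ x₀ d) :
    ∀ᵐ x ∂μ, Tendsto
      (fun r : ℝ =>
        ENNReal.log
            ((LorenzLike.hittingTime (LorenzLike.fibredMap T G) r x x₀ : ℕ∞) : ℝ≥0∞)
          / ((-Real.log r : ℝ) : EReal))
      (𝓝[>] 0) (𝓝 d) := by
  have := hF.isProbabilityMeasure
  exact hF.lipschitzDecay.tendsto_log_hittingTime hF.invariant hd
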